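/- Theorem 1 (Bi-Schatten-$p$ Norm Surrogate). For a real $a\times b$ matrix $A$ let $\sigma_1(A)\ge\sigma_2(A)\ge\cdots\ge 0$ be its singular values, with $\sigma_i(A)=0$ for $i>\operatorname{rank}(A)$, and for $q>0$ let $\|A\|_{S_q}=\bigl(\sum_{i=1}^{\min\{a,b\}}\sigma_i(A)^q\bigr)^{1/q}$. Let $p,p_1,p_2>0$ satisfy $1/p=1/p_1+1/p_2$, and let $X\in\mathbb{R}^{m\times n}$ have rank $r\le d$. Then $$\frac1p\|X\|_{S_p}^p=\min\Bigl\{\frac1{p_1}\|U\|_{S_{p_1}}^{p_1}+\frac1{p_2}\|V\|_{S_{p_2}}^{p_2}\;:\;U\in\mathbb{R}^{m\times d},\ V\in\mathbb{R}^{n\times d},\ X=UV^T\Bigr\},$$ and the minimum is attained. For $s>0$ write $\Sigma_X^{s}=\operatorname{diag}(\sigma_1(X)^s,\dots,\sigma_d(X)^s)\in\mathbb{R}^{d\times d}$, and $\Sigma_X=\Sigma_X^1$. There is a singular value decomposition $X=U_X\Sigma_XV_X^T$ in which $U_X\in\mathbb{R}^{m\times d}$, $V_X\in\mathbb{R}^{n\times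 d}$ and the first $\min\{m,n,d\}$ columns of each of $U_X$ and $V_X$ are orthonormal (further columns, present only when $d>\min\{m,n\}$, are arbitrary, for example zero). For every such decomposition, $U=U_X\Sigma_X^{p/p_1}$ and $V=V_X\Sigma_X^{p/p_2}$ satisfy $X=UV^T$ and attain the minimum. -/

import Mathlib

open scoped Matrix

/-- The singular values of a real `m × n` matrix in descending order, indexed from `0` and extended
by `0` beyond the rank: the square roots of the eigenvalues of `Xᵀ X`, through the linear map
between Euclidean spaces given by `X`. -/
noncomputable def singVal {m n : ℕ} (X : Matrix (Fin m) (Fin n) ℝ) (i : ℕ) : ℝ :=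
  (Matrix.toEuclideanLin X).singularValues i

/-- The Schatten-`p` (quasi-)norm `(∑_{i < min(m,n)} σᵢ(X) ^ p) ^ (1/p)`. -/
noncomputable def schattenNorm {m n : ℕ} (p : ℝ) (X : Matrix (Fin m) (Fin n) ℝ) : ℝ :=
  (∑ i ∈ Finset.range (min m n), singVal X i ^ p) ^ (1 / p)

/-- The `d × d` diagonal matrix with entries `σᵢ(X) ^ s`, `i < d`. For `s > 0` it is the
entrywise `s`-th power of `diag(σ₁(X), …, σ_r(X), 0, …, 0)`, with `r` the rank of `X`
(when `r ≤ d`). -/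
noncomputable def singDiagPow {m n : ℕ} (d : ℕ) (X : Matrix (Fin m) (Fin n) ℝ) (s : ℝ) :
    Matrix (Fin d) (Fin d) ℝ :=
  Matrix.diagonal fun i : Fin d => singVal X i ^ s

/-- `X = U_X Σ_X V_Xᵀ` is a singular value decomposition with inner dimension `d`: the
columns of `U_X` and of `V_X` with index `< min(m,n)` are orthonormal (all of the columns when
`d ≤ min(m,n)`). When `d > min(m,n)` the further columns, for instance zero columns, only meet zero
entries of `Σ_X`. -/
structure IsSVD {m n d : ℕ} (X : Matrix (Fin m) (Fin n) ℝ)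
    (UX : Matrix (Fin m) (Fin d) ℝ) (VX : Matrix (Fin n) (Fin d) ℝ) : Prop where
  left_orthonormal : ∀ i j : Fin d, (i : ℕ) < min m n → (j : ℕ) < min m n →
    (UXᵀ * UX) i j = if i = j then 1 else 0
  right_orthonormal : ∀ i j : Fin d, (i : ℕ) < min m n → (j : ℕ) < min m n →
    (VXᵀ * VX) i j = if i = j then 1 else 0
  eq_mul : X = UX * singDiagPow d X 1 * VXᵀ

/-!
The lower bound rests on Horn's inequality: the product of the first `k` singular values of
`U * Vᵀ` is at most the product of the first `k` singular values of `U` and of `Vᵀ`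
(`LinearMap.prod_singularValues_comp_le`). Such a product is the volume expansion factor
`LinearMap.normDet` of the map restricted to the span of its first `k` right singular vectors. These
factors multiply under composition, and on any `k`-dimensional subspace the factor is at most the
product of the first `k` singular values, because restriction to a subspace decreases each singular
value (`LinearMap.singularValues_comp_linearIsometry_le`).

These product inequalities imply `∑ σᵢ(U Vᵀ) ^ p ≤ ∑ (σᵢ(U) σᵢ(Vᵀ)) ^ p` for every `p > 0`
(`sum_rpow_le_of_prod_le`), and Young's inequality with weights `p / p₁` and `p / p₂` separates the
two factors. The singular values of `V` and `Vᵀ` give the same power sums because `Vᵀ V` and `V Vᵀ`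
have the same characteristic polynomial up to a power of the indeterminate.

The bound is attained because, for a singular value decomposition, `U_X Σ_X ^ s` has the diagonal
Gram matrix `Σ_X ^ (2 s)`, so its Schatten power sums can be read off the diagonal.
-/

open Module InnerProductSpace

/-! ### From product inequalities to sums of powers -/

/-- Abel summation: a decreasing nonnegative weight preserves nonnegativity of partial sums. -/
theorem sum_mul_nonneg_of_antitone {N : ℕ} {w z : ℕ → ℝ} (hw : Antitone w) (hw0 : ∀ i, 0 ≤ w i)
    (hz : ∀ k ≤ N, 0 ≤ ∑ i ∈ Finset.range k, z i) :
    0 ≤ ∑ i ∈ Finset.range N, w i * z i := by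
  have key : ∀ k ≤ N, w k * ∑ i ∈ Finset.range k, z i ≤ ∑ i ∈ Finset.range k, w i * z i := by
    intro k
    induction k with
    | zero => simp
    | succ k ih =>
      intro hk
      have h1 := ih (by omega)
      have h2 := mul_le_mul_of_nonneg_right (hw (Nat.le_succ k)) (hz (k + 1) hk)
      rw [Finset.sum_range_succ (fun i => w i * z i)]
      rw [Finset.sum_range_succ z] at h2 ⊢
      nlinarith
  exact (mul_nonneg (hw0 N) (hz N le_rfl)).trans (key N le_rfl)

/-- Weak log-majorization implies the inequality of sums of powers. No monotonicity of `b` is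
needed: the tangent-line bound for `exp` at `p log aᵢ` leaves a weighted sum of
`log bᵢ - log aᵢ` whose weights `aᵢ ^ p` decrease. -/
theorem sum_rpow_le_of_prod_le {N : ℕ} {a b : ℕ → ℝ} (ha : Antitone a) (ha0 : ∀ i, 0 ≤ a i)
    (hb0 : ∀ i, 0 ≤ b i)
    (hab : ∀ k, ∏ i ∈ Finset.range k, a i ≤ ∏ i ∈ Finset.range k, b i) {p : ℝ} (hp : 0 < p) :
    ∑ i ∈ Finset.range N, a i ^ p ≤ ∑ i ∈ Finset.range N, b i ^ p := by
  induction N with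
  | zero => simp
  | succ N ih =>
    rcases (ha0 N).eq_or_lt with h0 | hpos
    · rw [Finset.sum_range_succ, Finset.sum_range_succ, ← h0, Real.zero_rpow hp.ne']
      have := Real.rpow_nonneg (hb0 N) p
      linarith
    -- As `a` is antitone, a positive last term makes all terms positive, so the logarithms below are
    -- genuine.
    have hapos : ∀ i < N + 1, 0 < a i := fun i hi => hpos.trans_le (ha (by omega))
    have hbpos : ∀ i < N + 1, 0 < b i := by
      intro i hi
      refine (hb0 i).lt_of_ne' fun h => ?_
      have h1 : 0 < ∏ j ∈ Finset.range (N + 1), a j :=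
        Finset.prod_pos fun j hj => hapos j (Finset.mem_range.1 hj)
      have h2 := hab (N + 1)
      rw [Finset.prod_eq_zero (Finset.mem_range.2 hi) h] at h2
      linarith
    have hz : ∀ k ≤ N + 1, 0 ≤ ∑ i ∈ Finset.range k, p * (Real.log (b i) - Real.log (a i)) := by
      intro k hk
      have hlt : ∀ j ∈ Finset.range k, j < N + 1 :=
        fun j hj => (Finset.mem_range.1 hj).trans_le hk
      rw [← Finset.mul_sum, Finset.sum_sub_distrib,
        ← Real.log_prod fun j hj => (hbpos j (hlt j hj)).ne',
        ← Real.log_prod fun j hj => (hapos j (hlt j hj)).ne']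
      exact mul_nonneg hp.le (sub_nonneg.2 (Real.log_le_log
        (Finset.prod_pos fun j hj => hapos j (hlt j hj)) (hab k)))
    have hsum := sum_mul_nonneg_of_antitone (w := fun i => a i ^ p)
      (fun i j hij => Real.rpow_le_rpow (ha0 j) (ha hij) hp.le)
      (fun i => Real.rpow_nonneg (ha0 i) p) hz
    rw [← sub_nonneg, ← Finset.sum_sub_distrib]
    refine hsum.trans (Finset.sum_le_sum fun i hi => ?_)
    have hi' := Finset.mem_range.1 hi
    -- The tangent-line bound `1 + x ≤ exp x` at `x = p (log b - log a)`.
    have h1 := Real.add_one_le_exp (p * (Real.log (b i) - Real.log (a i)))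
    have h2 : b i ^ p = a i ^ p * Real.exp (p * (Real.log (b i) - Real.log (a i))) := by
      rw [Real.rpow_def_of_pos (hbpos i hi'), Real.rpow_def_of_pos (hapos i hi'), ← Real.exp_add]
      ring_nf
    rw [h2]
    nlinarith [Real.rpow_nonneg (ha0 i) p]

/-! ### Horn's inequality for the singular values of a composition -/

namespace LinearMap

variable {E F G : Type*} [NormedAddCommGroup E] [InnerProductSpace ℝ E] [FiniteDimensional ℝ E]
  [NormedAddCommGroup F] [InnerProductSpace ℝ F] [FiniteDimensional ℝ F]
  [NormedAddCommGroup G] [InnerProductSpace ℝ G] [FiniteDimensional ℝ G]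

/-- A right singular basis of `T`: the eigenvectors of `T† T`, ordered as the singular values. -/
noncomputable def rightSingularBasis (T : E →ₗ[ℝ] F) {n : ℕ} (hn : finrank ℝ E = n) :
    OrthonormalBasis (Fin n) ℝ E :=
  T.isSymmetric_adjoint_comp_self.eigenvectorBasis hn

theorem adjoint_apply_rightSingularBasis (T : E →ₗ[ℝ] F) {n : ℕ} (hn : finrank ℝ E = n)
    (i : Fin n) : T.adjoint (T (T.rightSingularBasis hn i)) =
      T.singularValues i ^ 2 • T.rightSingularBasis hn i := by
  rw [T.sq_singularValues_fin hn]
  exact T.isSymmetric_adjoint_comp_self.apply_eigenvectorBasis hn i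

theorem inner_apply_rightSingularBasis (T : E →ₗ[ℝ] F) {n : ℕ} (hn : finrank ℝ E = n)
    (i j : Fin n) : inner ℝ (T (T.rightSingularBasis hn i)) (T (T.rightSingularBasis hn j)) =
      if i = j then T.singularValues i ^ 2 else 0 := by
  rw [← LinearMap.adjoint_inner_left, adjoint_apply_rightSingularBasis, inner_smul_left,
    OrthonormalBasis.inner_eq_ite]
  simp

theorem norm_apply_sq_eq_sum (T : E →ₗ[ℝ] F) {n : ℕ} (hn : finrank ℝ E = n) (x : E) :
    ‖T x‖ ^ 2 = ∑ i : Fin n, T.singularValues i ^ 2 * (T.rightSingularBasis hn).repr x i ^ 2 := by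
  set b := T.rightSingularBasis hn with hb
  conv_lhs => rw [← b.sum_repr x]
  rw [← real_inner_self_eq_norm_sq]
  simp only [map_sum, map_smul, sum_inner, inner_sum, inner_smul_left, inner_smul_right, hb,
    inner_apply_rightSingularBasis]
  refine Finset.sum_congr rfl fun i _ => ?_
  simp
  ring

theorem sum_map_roots_charpoly_adjoint_comp_self (T : E →ₗ[ℝ] F) {n : ℕ}
    (hn : finrank ℝ E = n) (g : ℝ → ℝ) :
    ((T.adjoint ∘ₗ T).charpoly.roots.map g).sum = ∑ i : Fin n, g (T.singularValues i ^ 2) := by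
  simp_rw [T.sq_singularValues_fin hn]
  rw [T.isSymmetric_adjoint_comp_self.roots_charpoly_eq_eigenvalues hn, Multiset.map_map]
  rfl

/-- Precomposing with an isometric embedding decreases every singular value: by a dimension count
some nonzero `x` lies in the span of the first `i + 1` right singular vectors of `T ∘ S` while `S x`
is orthogonal to the first `i` right singular vectors of `T`. -/
theorem singularValues_comp_linearIsometry_le (T : E →ₗ[ℝ] F) (S : G →ₗᵢ[ℝ] E) (i : ℕ) :
    (T ∘ₗ S.toLinearMap).singularValues i ≤ T.singularValues i := by
  set w := finrank ℝ G with hw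
  set n := finrank ℝ E with hn
  rcases le_or_gt w i with hi | hi
  · rw [singularValues_of_finrank_le _ hi]
    exact T.singularValues_nonneg i
  have hwn : w ≤ n := LinearMap.finrank_le_finrank_of_injective S.injective
  set A := T ∘ₗ S.toLinearMap with hA
  set bG := A.rightSingularBasis hw.symm with hbG
  set bE := T.rightSingularBasis hn.symm with hbE
  -- The kernel consists of the `x` with no component beyond index `i` in `bG` and with `S x` having
  -- no component before index `i` in `bE`; the target has dimension `w - 1`.
  let φ : G →ₗ[ℝ] (Fin i → ℝ) × (Fin (w - i - 1) → ℝ) :=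
    LinearMap.prod
      (LinearMap.pi fun k => bE.toBasis.coord ⟨k, by omega⟩ ∘ₗ S.toLinearMap)
      (LinearMap.pi fun k => bG.toBasis.coord ⟨i + 1 + k, by omega⟩)
  have hφ : φ.ker ≠ ⊥ := by
    apply LinearMap.ker_ne_bot_of_finrank_lt
    simp
    omega
  obtain ⟨x, hx, hx0⟩ := Submodule.exists_mem_ne_zero_of_ne_bot hφ
  have hx' := LinearMap.mem_ker.1 hx
  have hE : ∀ j : Fin n, (j : ℕ) < i → bE.repr (S x) j = 0 := by
    intro j hj
    have := congrFun (congrArg Prod.fst hx') ⟨j, hj⟩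
    simpa [φ] using this
  have hG : ∀ j : Fin w, i < (j : ℕ) → bG.repr x j = 0 := by
    intro j hj
    have := congrFun (congrArg Prod.snd hx') ⟨j - (i + 1), by omega⟩
    have h2 : i + 1 + ((j : ℕ) - (i + 1)) = j := by omega
    simpa [φ, h2] using this
  have hnG : ‖x‖ ^ 2 = ∑ j, bG.repr x j ^ 2 := by
    rw [← bG.repr.norm_map, EuclideanSpace.real_norm_sq_eq]
  have hnE : ‖x‖ ^ 2 = ∑ j, bE.repr (S x) j ^ 2 := by
    rw [← S.norm_map, ← bE.repr.norm_map, EuclideanSpace.real_norm_sq_eq]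
  have hlow : A.singularValues i ^ 2 * ‖x‖ ^ 2 ≤ ‖A x‖ ^ 2 := by
    rw [A.norm_apply_sq_eq_sum hw.symm, hnG, Finset.mul_sum]
    refine Finset.sum_le_sum fun j _ => ?_
    rcases lt_or_ge i (j : ℕ) with hj | hj
    · rw [← hbG, hG j hj]; simp
    · exact mul_le_mul_of_nonneg_right (pow_le_pow_left₀ (A.singularValues_nonneg i)
        (A.singularValues_antitone hj) 2) (sq_nonneg _)
  have hupp : ‖A x‖ ^ 2 ≤ T.singularValues i ^ 2 * ‖x‖ ^ 2 := by
    have : A x = T (S x) := rfl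
    rw [this, T.norm_apply_sq_eq_sum hn.symm, hnE, Finset.mul_sum]
    refine Finset.sum_le_sum fun j _ => ?_
    rcases lt_or_ge (j : ℕ) i with hj | hj
    · rw [← hbE, hE j hj]; simp
    · exact mul_le_mul_of_nonneg_right (pow_le_pow_left₀ (T.singularValues_nonneg j)
        (T.singularValues_antitone hj) 2) (sq_nonneg _)
  have hpos : 0 < ‖x‖ ^ 2 := by positivity
  have hsq : A.singularValues i ^ 2 ≤ T.singularValues i ^ 2 :=
    le_of_mul_le_mul_right (hlow.trans hupp) hpos
  exact le_of_sq_le_sq hsq (T.singularValues_nonneg i)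

theorem normDet_comp_linearIsometry_le (T : E →ₗ[ℝ] F) (S : G →ₗᵢ[ℝ] E) :
    (T ∘ₗ S.toLinearMap).normDet ≤ ∏ i ∈ Finset.range (finrank ℝ G), T.singularValues i := by
  rw [normDet_eq_prod_singularValues]
  exact Finset.prod_le_prod (fun i _ => singularValues_nonneg _ i)
    fun i _ => singularValues_comp_linearIsometry_le T S i

/-- The product of the first `k` singular values is the volume expansion factor on the span of the
first `k` right singular vectors. -/
theorem exists_linearIsometry_normDet_comp_eq (T : E →ₗ[ℝ] F) {k : ℕ} (hk : k ≤ finrank ℝ E) :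
    ∃ S : EuclideanSpace ℝ (Fin k) →ₗᵢ[ℝ] E,
      (T ∘ₗ S.toLinearMap).normDet = ∏ i ∈ Finset.range k, T.singularValues i := by
  let b := T.rightSingularBasis rfl
  have hv : Orthonormal ℝ (b ∘ Fin.castLE hk) :=
    b.orthonormal.comp _ (Fin.castLE_injective hk)
  let e := EuclideanSpace.basisFun (Fin k) ℝ
  let S : EuclideanSpace ℝ (Fin k) →ₗᵢ[ℝ] E :=
    (e.toBasis.constr ℝ (b ∘ Fin.castLE hk)).isometryOfOrthonormal (v := e.toBasis)
      (by simp [e.orthonormal]) (by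
        convert hv using 1
        ext i
        simp)
  have hS : ∀ i, S (e i) = b (Fin.castLE hk i) := fun i => by
    rw [← e.coe_toBasis]
    exact e.toBasis.constr_basis ℝ (b ∘ Fin.castLE hk) i
  refine ⟨S, ?_⟩
  rw [← sq_eq_sq₀ (normDet_nonneg _) (Finset.prod_nonneg fun i _ => T.singularValues_nonneg i)]
  have h := normDet_sq_eq_det_gram (T ∘ₗ S.toLinearMap) e
  have hg : Matrix.gram ℝ (fun i => (T ∘ₗ S.toLinearMap) (e i)) =
      Matrix.diagonal fun i : Fin k => T.singularValues i ^ 2 := by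
    ext i j
    simp only [Matrix.gram_apply, LinearMap.comp_apply, LinearIsometry.coe_toLinearMap, hS, b,
      inner_apply_rightSingularBasis, Matrix.diagonal_apply]
    simp
  rw [hg, Matrix.det_diagonal, Fin.prod_univ_eq_prod_range (fun i => T.singularValues i ^ 2),
    Finset.prod_pow] at h
  exact h

/-- **Horn's inequality**. -/
theorem prod_singularValues_comp_le (g : F →ₗ[ℝ] G) (f : E →ₗ[ℝ] F) (k : ℕ) :
    ∏ i ∈ Finset.range k, (g ∘ₗ f).singularValues i ≤
      ∏ i ∈ Finset.range k, g.singularValues i * f.singularValues i := by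
  have hR : 0 ≤ ∏ i ∈ Finset.range k, g.singularValues i * f.singularValues i :=
    Finset.prod_nonneg fun i _ => mul_nonneg (g.singularValues_nonneg i) (f.singularValues_nonneg i)
  rcases lt_or_ge (finrank ℝ E) k with hk | hk
  · rwa [Finset.prod_eq_zero (Finset.mem_range.2 hk) (singularValues_of_finrank_le _ le_rfl)]
  obtain ⟨S, hS⟩ := exists_linearIsometry_normDet_comp_eq (g ∘ₗ f) hk
  rw [← hS, LinearMap.comp_assoc, normDet_comp]
  set h := f ∘ₗ S.toLinearMap with hh
  by_cases hker : h.ker = ⊥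
  · have hrange : finrank ℝ h.range = k := by
      rw [LinearMap.finrank_range_of_inj (LinearMap.ker_eq_bot.1 hker), finrank_euclideanSpace_fin]
    rw [Finset.prod_mul_distrib]
    have h1 := normDet_comp_linearIsometry_le g h.range.subtypeₗᵢ
    have h2 := normDet_comp_linearIsometry_le f S
    rw [hrange] at h1
    rw [finrank_euclideanSpace_fin] at h2
    exact mul_le_mul h1 h2 (normDet_nonneg _)
      (Finset.prod_nonneg fun i _ => g.singularValues_nonneg i)
  · rwa [normDet_eq_zero_iff_ker_ne_bot.2 hker, mul_zero]

end LinearMap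

/-! ### Schatten power sums of matrices -/

section SingVal

variable {m n d : ℕ}

theorem singVal_nonneg (A : Matrix (Fin m) (Fin n) ℝ) (i : ℕ) : 0 ≤ singVal A i :=
  LinearMap.singularValues_nonneg _ i

theorem singVal_antitone (A : Matrix (Fin m) (Fin n) ℝ) : Antitone (singVal A) :=
  LinearMap.singularValues_antitone _

theorem singVal_eq_zero_iff (A : Matrix (Fin m) (Fin n) ℝ) {i : ℕ} :
    singVal A i = 0 ↔ A.rank ≤ i := by
  rw [singVal, LinearMap.singularValues_eq_zero_iff_le_finrank_range,
    Matrix.rank_eq_finrank_range_toLin A (EuclideanSpace.basisFun (Fin m) ℝ).toBasis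
      (EuclideanSpace.basisFun (Fin n) ℝ).toBasis,
    ← Matrix.toEuclideanLin_eq_toLin_orthonormal]

theorem rank_le_min (A : Matrix (Fin m) (Fin n) ℝ) : A.rank ≤ min m n :=
  le_min (by simpa using A.rank_le_card_height) (by simpa using A.rank_le_card_width)

/-- The power sum may be taken over any range that covers the rank, since `0 ^ p = 0`. -/
theorem schattenNorm_rpow (A : Matrix (Fin m) (Fin n) ℝ) {p : ℝ} (hp : 0 < p) {N : ℕ}
    (hN : A.rank ≤ N) : schattenNorm p A ^ p = ∑ i ∈ Finset.range N, singVal A i ^ p := by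
  have hz : ∀ M, A.rank ≤ M → ∑ i ∈ Finset.range M, singVal A i ^ p =
      ∑ i ∈ Finset.range A.rank, singVal A i ^ p := by
    intro M hM
    refine (Finset.sum_subset (Finset.range_mono hM) fun i _ hi => ?_).symm
    rw [(singVal_eq_zero_iff A).2 (by simpa using hi), Real.zero_rpow hp.ne']
  rw [schattenNorm, ← Real.rpow_mul (Finset.sum_nonneg fun i _ =>
    Real.rpow_nonneg (singVal_nonneg A i) p), one_div_mul_cancel hp.ne', Real.rpow_one,
    hz _ (rank_le_min A), hz _ hN]

theorem adjoint_comp_toEuclideanLin (A : Matrix (Fin m) (Fin n) ℝ) :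
    LinearMap.adjoint (Matrix.toEuclideanLin A) ∘ₗ Matrix.toEuclideanLin A =
      Matrix.toEuclideanLin (Aᵀ * A) := by
  rw [← Matrix.toEuclideanLin_conjTranspose_eq_adjoint, Matrix.conjTranspose_eq_transpose_of_trivial]
  ext x i
  simp [Matrix.toLpLin_apply, Matrix.mulVec_mulVec]

theorem charpoly_adjoint_comp_toEuclideanLin (A : Matrix (Fin m) (Fin n) ℝ) :
    (LinearMap.adjoint (Matrix.toEuclideanLin A) ∘ₗ Matrix.toEuclideanLin A).charpoly =
      (Aᵀ * A).charpoly := by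
  rw [adjoint_comp_toEuclideanLin, Matrix.toEuclideanLin_eq_toLin_orthonormal]
  exact Matrix.charpoly_toLin _ _

theorem schattenNorm_rpow_eq_sum_roots (A : Matrix (Fin m) (Fin n) ℝ) {p : ℝ} (hp : 0 < p) :
    schattenNorm p A ^ p = ((Aᵀ * A).charpoly.roots.map fun x => √x ^ p).sum := by
  rw [schattenNorm_rpow A hp ((rank_le_min A).trans (min_le_right _ _)),
    ← charpoly_adjoint_comp_toEuclideanLin,
    LinearMap.sum_map_roots_charpoly_adjoint_comp_self _ finrank_euclideanSpace_fin,
    ← Fin.sum_univ_eq_sum_range (fun i => singVal A i ^ p)]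
  refine Finset.sum_congr rfl fun i _ => ?_
  rw [Real.sqrt_sq (LinearMap.singularValues_nonneg _ _), singVal]

theorem schattenNorm_transpose_rpow (A : Matrix (Fin m) (Fin n) ℝ) {p : ℝ} (hp : 0 < p) :
    schattenNorm p Aᵀ ^ p = schattenNorm p A ^ p := by
  rw [schattenNorm_rpow_eq_sum_roots _ hp, schattenNorm_rpow_eq_sum_roots _ hp,
    Matrix.transpose_transpose]
  have h := congrArg Polynomial.roots (Matrix.charpoly_mul_comm' A Aᵀ)
  have hne : ∀ (k : ℕ) {q : Polynomial ℝ}, q.Monic → Polynomial.X ^ k * q ≠ 0 := fun k q hq =>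
    ((Polynomial.monic_X_pow k).mul hq).ne_zero
  rw [Polynomial.roots_mul (hne _ (Matrix.charpoly_monic _)),
    Polynomial.roots_mul (hne _ (Matrix.charpoly_monic _)), Polynomial.roots_X_pow,
    Polynomial.roots_X_pow] at h
  have h2 := congrArg (fun s => (Multiset.map (fun x => √x ^ p) s).sum) h
  simpa [Multiset.map_nsmul, Multiset.sum_nsmul, Real.zero_rpow hp.ne'] using h2

theorem schattenNorm_rpow_of_transpose_mul_self_eq_diagonal (A : Matrix (Fin m) (Fin n) ℝ)
    {f : Fin n → ℝ} (hA : Aᵀ * A = Matrix.diagonal f) {p : ℝ} (hp : 0 < p) :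
    schattenNorm p A ^ p = ∑ i, √(f i) ^ p := by
  rw [schattenNorm_rpow_eq_sum_roots A hp, hA, Matrix.charpoly_diagonal, Polynomial.roots_prod]
  · simp [List.sum_ofFn]
  · simp [Finset.prod_ne_zero_iff, Polynomial.X_sub_C_ne_zero]

theorem toEuclideanLin_mul (A : Matrix (Fin m) (Fin d) ℝ) (B : Matrix (Fin d) (Fin n) ℝ) :
    Matrix.toEuclideanLin (A * B) = Matrix.toEuclideanLin A ∘ₗ Matrix.toEuclideanLin B := by
  ext x i
  simp [Matrix.toLpLin_apply, Matrix.mulVec_mulVec]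

/-! ### The lower bound -/

/-- Weighted AM-GM applied to `a ^ p₁` and `b ^ p₂`, with weights `p / p₁` and `p / p₂`. -/
theorem young_rpow_mul {p p₁ p₂ : ℝ} (hp : 0 < p) (hp₁ : 0 < p₁) (hp₂ : 0 < p₂)
    (hsum : 1 / p = 1 / p₁ + 1 / p₂) {a b : ℝ} (ha : 0 ≤ a) (hb : 0 ≤ b) :
    1 / p * (a * b) ^ p ≤ 1 / p₁ * a ^ p₁ + 1 / p₂ * b ^ p₂ := by
  have hw : p / p₁ + p / p₂ = 1 := by
    have := congrArg (p * ·) hsum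
    simp only [mul_add, mul_one_div, div_self hp.ne'] at this
    exact this.symm
  have h := Real.geom_mean_le_arith_mean2_weighted (div_nonneg hp.le hp₁.le)
    (div_nonneg hp.le hp₂.le) (Real.rpow_nonneg ha p₁) (Real.rpow_nonneg hb p₂) hw
  rw [← Real.rpow_mul ha, ← Real.rpow_mul hb, mul_div_cancel₀ _ hp₁.ne',
    mul_div_cancel₀ _ hp₂.ne', ← Real.mul_rpow ha hb] at h
  calc 1 / p * (a * b) ^ p ≤ 1 / p * (p / p₁ * a ^ p₁ + p / p₂ * b ^ p₂) :=
        mul_le_mul_of_nonneg_left h (by positivity)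
    _ = _ := by field_simp

theorem schattenNorm_rpow_mul_transpose_le {p p₁ p₂ : ℝ} (hp : 0 < p) (hp₁ : 0 < p₁) (hp₂ : 0 < p₂)
    (hsum : 1 / p = 1 / p₁ + 1 / p₂) (U : Matrix (Fin m) (Fin d) ℝ)
    (V : Matrix (Fin n) (Fin d) ℝ) :
    1 / p * schattenNorm p (U * Vᵀ) ^ p ≤
      1 / p₁ * schattenNorm p₁ U ^ p₁ + 1 / p₂ * schattenNorm p₂ V ^ p₂ := by
  have hN : ∀ {k l : ℕ} (A : Matrix (Fin k) (Fin l) ℝ), k ≤ m + n + d → A.rank ≤ m + n + d :=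
    fun A h => (rank_le_min A).trans ((min_le_left _ _).trans h)
  rw [← schattenNorm_transpose_rpow V hp₂, schattenNorm_rpow _ hp (hN _ (by omega)),
    schattenNorm_rpow U hp₁ (hN _ (by omega)), schattenNorm_rpow Vᵀ hp₂ (hN _ (by omega))]
  have hlog : ∀ k, ∏ i ∈ Finset.range k, singVal (U * Vᵀ) i ≤
      ∏ i ∈ Finset.range k, singVal U i * singVal Vᵀ i := by
    intro k
    simp only [singVal, toEuclideanLin_mul]
    exact LinearMap.prod_singularValues_comp_le _ _ k
  have h1 := sum_rpow_le_of_prod_le (N := m + n + d) (singVal_antitone (U * Vᵀ))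
    (singVal_nonneg _) (fun i => mul_nonneg (singVal_nonneg U i) (singVal_nonneg Vᵀ i)) hlog hp
  refine (mul_le_mul_of_nonneg_left h1 (by positivity)).trans ?_
  rw [Finset.mul_sum, Finset.mul_sum, Finset.mul_sum, ← Finset.sum_add_distrib]
  exact Finset.sum_le_sum fun i _ =>
    young_rpow_mul hp hp₁ hp₂ hsum (singVal_nonneg U i) (singVal_nonneg Vᵀ i)

/-! ### Factors built from a singular value decomposition -/

theorem singDiagPow_mul_singDiagPow (X : Matrix (Fin m) (Fin n) ℝ) {s t : ℝ} (hst : s + t ≠ 0) :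
    singDiagPow d X s * singDiagPow d X t = singDiagPow d X (s + t) := by
  rw [singDiagPow, singDiagPow, singDiagPow, Matrix.diagonal_mul_diagonal]
  congr 1
  ext i
  rw [Real.rpow_add' (singVal_nonneg X i) hst]

/-- Columns of `W` with index at least `min m n` are unconstrained, but they are multiplied by zero
entries of the diagonal matrix. -/
theorem schattenNorm_mul_singDiagPow_rpow {k : ℕ} {X : Matrix (Fin m) (Fin n) ℝ}
    (hr : X.rank ≤ d) {W : Matrix (Fin k) (Fin d) ℝ}
    (hW : ∀ i j : Fin d, (i : ℕ) < min m n → (j : ℕ) < min m n →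
      (Wᵀ * W) i j = if i = j then 1 else 0) {p q : ℝ} (hp : 0 < p) (hq : 0 < q) :
    schattenNorm q (W * singDiagPow d X (p / q)) ^ q = schattenNorm p X ^ p := by
  have hdiag : (W * singDiagPow d X (p / q))ᵀ * (W * singDiagPow d X (p / q)) =
      Matrix.diagonal fun i : Fin d => (singVal X i ^ (p / q)) ^ 2 := by
    have hzero : ∀ i : Fin d, min m n ≤ (i : ℕ) → singVal X i ^ (p / q) = 0 := fun i hi => by
      rw [(singVal_eq_zero_iff X).2 ((rank_le_min X).trans hi),
        Real.zero_rpow (div_pos hp hq).ne']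
    rw [Matrix.transpose_mul, Matrix.mul_assoc, ← Matrix.mul_assoc Wᵀ, singDiagPow,
      Matrix.diagonal_transpose]
    ext i j
    rw [Matrix.diagonal_mul, Matrix.mul_diagonal]
    rcases lt_or_ge (i : ℕ) (min m n) with hi | hi
    · rcases lt_or_ge (j : ℕ) (min m n) with hj | hj
      · rw [hW i j hi hj, Matrix.diagonal_apply]
        split_ifs with hij
        · subst hij; ring
        · ring
      · rw [hzero j hj, Matrix.diagonal_apply_ne _ (by rintro rfl; omega)]
        ring
    · rw [hzero i hi, Matrix.diagonal_apply]
      split_ifs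
      · rw [hzero i hi]; ring
      · ring
  rw [schattenNorm_rpow_of_transpose_mul_self_eq_diagonal _ hdiag hq, schattenNorm_rpow X hp hr,
    ← Fin.sum_univ_eq_sum_range]
  refine Finset.sum_congr rfl fun i _ => ?_
  rw [Real.sqrt_sq (Real.rpow_nonneg (singVal_nonneg X i) _), ← Real.rpow_mul (singVal_nonneg X i),
    div_mul_cancel₀ _ hq.ne']

theorem exists_isSVD (X : Matrix (Fin m) (Fin n) ℝ) (hr : X.rank ≤ d) :
    ∃ (UX : Matrix (Fin m) (Fin d) ℝ) (VX : Matrix (Fin n) (Fin d) ℝ), IsSVD X UX VX := by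
  set T := Matrix.toEuclideanLin X with hT
  let v := T.rightSingularBasis finrank_euclideanSpace_fin
  have hrn : X.rank ≤ n := (rank_le_min X).trans (min_le_right _ _)
  have hσ : ∀ i, i < X.rank → T.singularValues i ≠ 0 := fun i hi h =>
    absurd ((singVal_eq_zero_iff X).1 h) (by omega)
  -- The left singular vectors with nonzero singular value; they are extended below to an
  -- orthonormal basis `u`.
  let u₀ : Fin m → EuclideanSpace ℝ (Fin m) := fun j =>
    if h : (j : ℕ) < n then (T.singularValues j)⁻¹ • T (v ⟨j, h⟩) else 0
  have hu₀ : Orthonormal ℝ (Set.domRestrict {j : Fin m | (j : ℕ) < X.rank} u₀) := by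
    rw [orthonormal_iff_ite]
    rintro ⟨i, hi⟩ ⟨j, hj⟩
    have hi' : (i : ℕ) < X.rank := hi
    have hj' : (j : ℕ) < X.rank := hj
    have hin : (i : ℕ) < n := by omega
    have hjn : (j : ℕ) < n := by omega
    simp only [Set.domRestrict_apply, u₀, dif_pos hin, dif_pos hjn, inner_smul_left,
      inner_smul_right, v, LinearMap.inner_apply_rightSingularBasis, Fin.mk.injEq,
      Subtype.mk.injEq, Fin.val_inj, conj_trivial]
    split_ifs with hij
    · subst hij
      have := hσ i hi'
      field_simp
    · simp
  obtain ⟨u, hu⟩ := hu₀.exists_orthonormalBasis_extension_of_card_eq (by simp)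
  have hT0 : ∀ k : Fin n, X.rank ≤ k → T (v k) = 0 := by
    intro k hk
    have h := T.inner_apply_rightSingularBasis finrank_euclideanSpace_fin k k
    rw [if_pos rfl, show T.singularValues k = 0 from (singVal_eq_zero_iff X).2 hk,
      zero_pow two_ne_zero] at h
    exact inner_self_eq_zero.1 h
  let UX : Matrix (Fin m) (Fin d) ℝ := Matrix.of fun a j =>
    if h : (j : ℕ) < m then u ⟨j, h⟩ a else 0
  let VX : Matrix (Fin n) (Fin d) ℝ := Matrix.of fun a j =>
    if h : (j : ℕ) < n then v ⟨j, h⟩ a else 0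
  refine ⟨UX, VX, fun i j hi hj => ?_, fun i j hi hj => ?_, ?_⟩
  · have := orthonormal_iff_ite.1 u.orthonormal ⟨j, by omega⟩ ⟨i, by omega⟩
    simp only [PiLp.inner_apply, RCLike.inner_apply, conj_trivial, Fin.mk.injEq, Fin.val_inj] at this
    simp only [Matrix.mul_apply, Matrix.transpose_apply, UX, Matrix.of_apply,
      dif_pos (lt_min_iff.1 hi).1, dif_pos (lt_min_iff.1 hj).1, this, eq_comm]
  · have := orthonormal_iff_ite.1 v.orthonormal ⟨j, by omega⟩ ⟨i, by omega⟩
    simp only [PiLp.inner_apply, RCLike.inner_apply, conj_trivial, Fin.mk.injEq, Fin.val_inj] at this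
    simp only [Matrix.mul_apply, Matrix.transpose_apply, VX, Matrix.of_apply,
      dif_pos (lt_min_iff.1 hi).2, dif_pos (lt_min_iff.1 hj).2, this, eq_comm]
  -- Both sides are compared on the right singular basis.
  apply Matrix.toEuclideanLin.injective
  refine v.toBasis.ext fun k => ?_
  have hV : VXᵀ *ᵥ (v k).ofLp = fun j : Fin d => if (j : ℕ) = k then 1 else 0 := by
    ext j
    simp only [Matrix.mulVec, dotProduct, Matrix.transpose_apply, VX, Matrix.of_apply]
    split_ifs with h1 h2
    · have := orthonormal_iff_ite.1 v.orthonormal k ⟨j, h1⟩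
      rw [if_pos (Fin.ext h2.symm)] at this
      simpa [PiLp.inner_apply] using this
    · have := orthonormal_iff_ite.1 v.orthonormal k ⟨j, h1⟩
      rw [if_neg fun h => h2 (congrArg Fin.val h).symm] at this
      simpa [PiLp.inner_apply] using this
    · omega
    · simp
  have hUV : (UX * singDiagPow d X 1 * VXᵀ) *ᵥ (v k).ofLp = (T (v k)).ofLp := by
    rw [← Matrix.mulVec_mulVec, hV, ← Matrix.mulVec_mulVec]
    ext a
    rw [Matrix.mulVec, dotProduct]
    simp only [singDiagPow, Matrix.mulVec_diagonal, Real.rpow_one, mul_ite, mul_one, mul_zero]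
    by_cases hk : (k : ℕ) < X.rank
    · have hkm : (k : ℕ) < m := by have := rank_le_min X; omega
      rw [Finset.sum_eq_single (⟨k, by omega⟩ : Fin d)]
      · have hku : u ⟨k, hkm⟩ = (T.singularValues k)⁻¹ • T (v k) := by
          rw [hu ⟨k, hkm⟩ hk]
          simp [u₀]
        have := hσ k hk
        simp only [UX, Matrix.of_apply, dif_pos hkm, hku, singVal, ← hT, if_true,
          PiLp.smul_apply, smul_eq_mul]
        field_simp
      · intro j _ hj
        exact if_neg fun h => hj (Fin.ext h)
      · simp
    · rw [hT0 k (not_lt.1 hk)]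
      refine Finset.sum_eq_zero fun j _ => ?_
      split_ifs with hj
      · rw [(singVal_eq_zero_iff X).2 (by omega)]
        simp
      · simp
  rw [v.coe_toBasis, ← hT, Matrix.toLpLin_apply 2 2 (UX * singDiagPow d X 1 * VXᵀ), hUV]

end SingVal

theorem theorem1 {m n d : ℕ} (X : Matrix (Fin m) (Fin n) ℝ) (hr : X.rank ≤ d)
    (p p₁ p₂ : ℝ) (hp : 0 < p) (hp₁ : 0 < p₁) (hp₂ : 0 < p₂)
    (hsum : 1 / p = 1 / p₁ + 1 / p₂) :
    IsLeast
      {t : ℝ | ∃ (U : Matrix (Fin m) (Fin d) ℝ) (V : Matrix (Fin n) (Fin d) ℝ),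
        X = U * Vᵀ ∧
        t = (1 / p₁) * schattenNorm p₁ U ^ p₁ + (1 / p₂) * schattenNorm p₂ V ^ p₂}
      ((1 / p) * schattenNorm p X ^ p) ∧
    (∃ (UX : Matrix (Fin m) (Fin d) ℝ) (VX : Matrix (Fin n) (Fin d) ℝ), IsSVD X UX VX) ∧
    ∀ (UX : Matrix (Fin m) (Fin d) ℝ) (VX : Matrix (Fin n) (Fin d) ℝ), IsSVD X UX VX →
      X = (UX * singDiagPow d X (p / p₁)) * (VX * singDiagPow d X (p / p₂))ᵀ ∧
      (1 / p) * schattenNorm p X ^ p =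
        (1 / p₁) * schattenNorm p₁ (UX * singDiagPow d X (p / p₁)) ^ p₁ +
        (1 / p₂) * schattenNorm p₂ (VX * singDiagPow d X (p / p₂)) ^ p₂ := by
  have hw : p / p₁ + p / p₂ = 1 := by
    rw [← mul_one_div p p₁, ← mul_one_div p p₂, ← mul_add, ← hsum, mul_one_div_cancel hp.ne']
  have hattain : ∀ (UX : Matrix (Fin m) (Fin d) ℝ) (VX : Matrix (Fin n) (Fin d) ℝ),
      IsSVD X UX VX →
      X = (UX * singDiagPow d X (p / p₁)) * (VX * singDiagPow d X (p / p₂))ᵀ ∧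
      (1 / p) * schattenNorm p X ^ p =
        (1 / p₁) * schattenNorm p₁ (UX * singDiagPow d X (p / p₁)) ^ p₁ +
        (1 / p₂) * schattenNorm p₂ (VX * singDiagPow d X (p / p₂)) ^ p₂ := by
    intro UX VX h
    refine ⟨?_, ?_⟩
    · have hT : (singDiagPow d X (p / p₂))ᵀ = singDiagPow d X (p / p₂) :=
        Matrix.diagonal_transpose _
      rw [Matrix.transpose_mul, hT, Matrix.mul_assoc, ← Matrix.mul_assoc (singDiagPow d X (p / p₁)),
        singDiagPow_mul_singDiagPow X (by rw [hw]; exact one_ne_zero), hw, ← Matrix.mul_assoc]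
      exact h.eq_mul
    · rw [schattenNorm_mul_singDiagPow_rpow hr h.left_orthonormal hp hp₁,
        schattenNorm_mul_singDiagPow_rpow hr h.right_orthonormal hp hp₂, hsum]
      ring
  obtain ⟨UX, VX, hSVD⟩ := exists_isSVD X hr
  refine ⟨⟨⟨_, _, hattain UX VX hSVD⟩, ?_⟩, ⟨UX, VX, hSVD⟩, hattain⟩
  rintro t ⟨U, V, rfl, rfl⟩
  exact schattenNorm_rpow_mul_transpose_le hp hp₁ hp₂ hsum U V
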